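/- Let $\mathcal H$ be a complex Hilbert space and let $\mathcal N\subseteq\mathcal M\subseteq B(\mathcal H)$ be von Neumann algebras (both containing $\mathbb 1_{\mathcal H}$). A conditional expectation $E:\mathcal M\to\mathcal N$ is a positive linear map with $E(a)=a$ and $E(axb)=aE(x)b$ for all $a,b\in\mathcal N$, $x\in\mathcal M$; neither faithfulness nor any continuity is assumed. It is called normal if it is continuous for the $\sigma$-weak topologies of $\mathcal M$ and $\mathcal N$. Suppose that there are a conditional expectation $E:\mathcal M\to\mathcal N$ and a constant $\lambda>0$ satisfying the Pimsner–Popa inequality $$E(x^*x)\ \ge\ \lambda\, x^*x\qquad\text{for all }x\in\mathcal M .$$ Then every conditional expectation $F:\mathcal M\to\mathcal N$ is normal (in particular, $E$ itself is normal). -/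

import Mathlib

noncomputable section

/-- The σ-weak (ultraweak) topology on the bounded operators on `H`: the initial topology for the
functionals `x ↦ ∑ₙ ⟪ηₙ, x ξₙ⟫`, where `ξ` and `η` range over the square-summable sequences
of vectors of `H`. (All these series converge absolutely.) -/
abbrev sigmaWeakTopology (H : Type*) [NormedAddCommGroup H] [InnerProductSpace ℂ H] :
    TopologicalSpace (H →L[ℂ] H) :=
  ⨅ (ξ : ℕ → H) (η : ℕ → H) (_ : Summable fun n => ‖ξ n‖ ^ 2) (_ : Summable fun n => ‖η n‖ ^ 2),
    TopologicalSpace.induced (fun x : H →L[ℂ] H => ∑' n, inner ℂ (η n) (x (ξ n))) inferInstance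

namespace VonNeumannAlgebra

variable {H : Type*} [NormedAddCommGroup H] [InnerProductSpace ℂ H] [CompleteSpace H]

/-- The σ-weak topology of a von Neumann algebra `M ⊆ B(H)`. -/
abbrev sigmaWeak (M : VonNeumannAlgebra H) : TopologicalSpace M.toStarSubalgebra :=
  TopologicalSpace.induced (fun x : M.toStarSubalgebra => (x : H →L[ℂ] H)) (sigmaWeakTopology H)

/-- A linear map between von Neumann algebras is normal if it is σ-weakly continuous. -/
def IsNormalMap {M N : VonNeumannAlgebra H} (F : M.toStarSubalgebra →ₗ[ℂ] N.toStarSubalgebra) :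
    Prop :=
  @Continuous _ _ M.sigmaWeak N.sigmaWeak F

/-- A conditional expectation of a von Neumann algebra `M` onto a von Neumann subalgebra `N`:
a positive linear map `M → N` which restricts to the identity on `N` and is `N`-bimodular.
Neither faithfulness nor any continuity is required. Positivity of an element of `M` or `N` is
its positivity as an operator on `H`. -/
structure IsConditionalExpectation {M N : VonNeumannAlgebra H} (hNM : N ≤ M)
    (E : M.toStarSubalgebra →ₗ[ℂ] N.toStarSubalgebra) : Prop where
  nonneg : ∀ x : M.toStarSubalgebra, 0 ≤ (x : H →L[ℂ] H) → 0 ≤ (E x : H →L[ℂ] H)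
  apply_of_mem : ∀ a : N.toStarSubalgebra, E ⟨a, hNM a.2⟩ = a
  map_mul_mul : ∀ (a b : N.toStarSubalgebra) (x : M.toStarSubalgebra),
    E (⟨a, hNM a.2⟩ * x * ⟨b, hNM b.2⟩) = a * E x * b

/-- The Pimsner–Popa inequality with constant `c`: `E(x* x) ≥ c x* x` for all `x` in `M`,
in the order of bounded self-adjoint operators on `H`. -/
def PimsnerPopaInequality {M N : VonNeumannAlgebra H}
    (E : M.toStarSubalgebra →ₗ[ℂ] N.toStarSubalgebra) (c : ℝ) : Prop :=
  ∀ x : M.toStarSubalgebra,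
    (c : ℂ) • ((star x * x : M.toStarSubalgebra) : H →L[ℂ] H) ≤ (E (star x * x) : H →L[ℂ] H)

end VonNeumannAlgebra

end

open Filter Topology
open scoped InnerProductSpace ComplexOrder

/-! Let positive contractions `x` of `M` increase strongly to `g` along a chain. The elements `E x`
increase to some `s` in `N`, and it does not matter whether `s = E g`. The Pimsner–Popa inequality
for differences of chain elements gives `c (g - x) ≤ s - E x` in the limit. The right side lies in
`N`, so applying `F` leaves it fixed and yields `c F (g - x) ≤ s - E x`, which tends strongly to
`0`. Hence `F` is continuous along increasing chains (`exists_forall_smul_apply_sub_le`).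

What remains is the classical fact that an order-continuous positive functional `ψ` is σ-weakly
continuous (`exists_eq_inner_amplify`), proved here with chains only. In the GNS representation of
`ψ`, the vectors whose orbits are dominated by orbits in `ℓ²(ℕ, H)` form a closed subspace
(`isClosed_normalPart`). Zorn's lemma gives a maximal `m` in `[0, 1]` with `π m Ω` in it: order
continuity handles chains, and `exists_apply_mem_normalPart` enlarges `m` unless `m = 1`. So `Ω`
itself is dominated, and a Radon–Nikodym square root (`StarAlgHom.exists_inner_eq_of_norm_le`) turns
domination into equality. Taking `ψ x = ⟪ξ, (F x ⊗ 1) ξ⟫` and polarizing gives normality of `F`. -/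

/-! ### Order estimates in C*-algebras -/

theorem CStarAlgebra.mul_self_le_norm_smul {A : Type*} [CStarAlgebra A] [PartialOrder A]
    [StarOrderedRing A] {a : A} (ha : 0 ≤ a) : a * a ≤ ‖a‖ • a := by
  have hs : star (CFC.sqrt a) = CFC.sqrt a := (CFC.sqrt_nonneg a).isSelfAdjoint
  have hss := CFC.sqrt_mul_sqrt_self a ha
  have key : star (CFC.sqrt a) * a * CFC.sqrt a ≤ ‖a‖ • (star (CFC.sqrt a) * CFC.sqrt a) :=
    CStarAlgebra.star_left_conjugate_le_norm_smul
  have h1 : star (CFC.sqrt a) * a * CFC.sqrt a = a * a := by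
    rw [hs]
    calc CFC.sqrt a * a * CFC.sqrt a
        = CFC.sqrt a * (CFC.sqrt a * CFC.sqrt a) * CFC.sqrt a := by rw [hss]
      _ = CFC.sqrt a * CFC.sqrt a * (CFC.sqrt a * CFC.sqrt a) := by simp only [mul_assoc]
      _ = a * a := by rw [hss]
  rwa [h1, hs, hss] at key

theorem CStarAlgebra.mul_self_le_self {A : Type*} [CStarAlgebra A] [PartialOrder A]
    [StarOrderedRing A] {a : A} (h0 : 0 ≤ a) (h1 : a ≤ 1) : a * a ≤ a := by
  refine (CStarAlgebra.mul_self_le_norm_smul h0).trans ?_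
  have hn : ‖a‖ ≤ 1 := (CStarAlgebra.norm_le_one_iff_of_nonneg _ h0).2 h1
  simpa using smul_le_smul_of_nonneg_right hn h0

/-- `a x* x a ≤ ‖x* x‖ a² ≤ ‖x* x‖ ‖a‖ a`. Thus a bound between functionals on the interval `[0, a]`
alone controls the left ideal generated by `a`. The `+ 1` in the constant only makes it invertible.
-/
theorem CStarAlgebra.exists_star_mul_self_mul_eq_smul {A : Type*} [CStarAlgebra A] [PartialOrder A]
    [StarOrderedRing A] {a : A} (ha : 0 ≤ a) (x : A) :
    ∃ (C : ℝ) (y : A), 0 ≤ C ∧ 0 ≤ y ∧ y ≤ a ∧ star (x * a) * (x * a) = (C : ℂ) • y := by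
  set z := star (x * a) * (x * a) with hz
  set C : ℝ := ‖star x * x‖ * ‖a‖ + 1 with hC
  have hC0 : 0 < C := by positivity
  have hzle : z ≤ C • a := by
    have h1 : z ≤ ‖star x * x‖ • (a * a) := by
      have := CStarAlgebra.star_left_conjugate_le_norm_smul (a := a) (b := star x * x)
      rw [ha.isSelfAdjoint.star_eq] at this
      rw [hz, star_mul, ha.isSelfAdjoint.star_eq]
      simpa only [mul_assoc] using this
    have h2 : ‖star x * x‖ • (a * a) ≤ ‖star x * x‖ • (‖a‖ • a) :=
      smul_le_smul_of_nonneg_left (CStarAlgebra.mul_self_le_norm_smul ha) (norm_nonneg _)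
    rw [hC, add_smul, one_smul, mul_smul]
    exact (h1.trans h2).trans (le_add_of_nonneg_right ha)
  refine ⟨C, C⁻¹ • z, hC0.le, smul_nonneg (by positivity) (star_mul_self_nonneg _), ?_, ?_⟩
  · have := smul_le_smul_of_nonneg_left hzle (inv_nonneg.2 hC0.le)
    rwa [smul_smul, inv_mul_cancel₀ hC0.ne', one_smul] at this
  · rw [Complex.coe_smul, smul_smul, mul_inv_cancel₀ hC0.ne', one_smul]

theorem IsChain.isDirectedOrder_coe {α : Type*} [Preorder α] {c : Set α}
    (hc : IsChain (· ≤ ·) c) : IsDirectedOrder c :=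
  ⟨fun x y => by
    rcases hc.total x.2 y.2 with h | h
    exacts [⟨y, h, le_rfl⟩, ⟨x, le_rfl, h⟩]⟩

/-! ### Strong limits of monotone nets of operators -/

section StrongLimits

variable {H : Type*} [NormedAddCommGroup H] [InnerProductSpace ℂ H] [CompleteSpace H]

namespace ContinuousLinearMap

theorem re_inner_apply_mono {H : Type*} [NormedAddCommGroup H] [InnerProductSpace ℂ H]
    {a b : H →L[ℂ] H} (h : a ≤ b) (ξ : H) :
    (⟪ξ, a ξ⟫_ℂ).re ≤ (⟪ξ, b ξ⟫_ℂ).re := by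
  have := (ContinuousLinearMap.le_def a b).1 h |>.re_inner_nonneg_right ξ
  simpa [inner_sub_right] using this

theorem norm_apply_sq_le_of_nonneg {a : H →L[ℂ] H} (ha : 0 ≤ a) (ξ : H) :
    ‖a ξ‖ ^ 2 ≤ ‖a‖ * (⟪ξ, a ξ⟫_ℂ).re := by
  have key := CStarAlgebra.mul_self_le_norm_smul ha
  nth_rw 1 [← ha.isSelfAdjoint.star_eq] at key
  have := re_inner_apply_mono key ξ
  simp only [ContinuousLinearMap.star_eq_adjoint, mul_apply_eq_comp,
    ContinuousLinearMap.adjoint_inner_right, inner_self_eq_norm_sq_to_K,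
    smul_apply, inner_smul_right_eq_smul] at this
  simpa [← Complex.ofReal_pow] using this

/-- Turns convergence of quadratic forms along a bounded monotone net into strong convergence. -/
theorem norm_apply_sq_le_of_le {a b : H →L[ℂ] H} {C : ℝ} (h : a ≤ b) (hC : ‖b - a‖ ≤ C) (ξ : H) :
    ‖b ξ - a ξ‖ ^ 2 ≤ C * ((⟪ξ, b ξ⟫_ℂ).re - (⟪ξ, a ξ⟫_ℂ).re) := by
  have h0 : 0 ≤ b - a := sub_nonneg.2 h
  have h1 := norm_apply_sq_le_of_nonneg h0 ξ
  have h2 := re_inner_apply_mono h ξ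
  simp only [sub_apply, inner_sub_right, Complex.sub_re] at h1
  exact h1.trans (mul_le_mul_of_nonneg_right hC (sub_nonneg.2 h2))

/-- A bounded increasing net of positive operators converges strongly. -/
theorem exists_tendsto_of_monotone {ι : Type*} [Preorder ι] [IsDirectedOrder ι] [Nonempty ι]
    {f : ι → H →L[ℂ] H} (hf : Monotone f) (h0 : ∀ i, 0 ≤ f i) {b : H →L[ℂ] H}
    (hb : ∀ i, f i ≤ b) :
    ∃ g : H →L[ℂ] H, ∀ ξ, Tendsto (fun i => f i ξ) atTop (𝓝 (g ξ)) := by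
  have hn : ∀ i, ‖f i‖ ≤ ‖b‖ := fun i => CStarAlgebra.norm_le_norm_of_nonneg_of_le (h0 i) (hb i)
  have hC : ∀ i j, ‖f j - f i‖ ≤ 2 * ‖b‖ := fun i j =>
    (norm_sub_le _ _).trans (by linarith [hn i, hn j])
  have key : ∀ ξ, ∃ η, Tendsto (fun i => f i ξ) atTop (𝓝 η) := by
    intro ξ
    set r : ι → ℝ := fun i => (⟪ξ, f i ξ⟫_ℂ).re with hr
    have hmono : Monotone r := fun i j hij => re_inner_apply_mono (hf hij) ξ
    have hbdd : BddAbove (Set.range r) :=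
      ⟨(⟪ξ, b ξ⟫_ℂ).re, by rintro _ ⟨i, rfl⟩; exact re_inner_apply_mono (hb i) ξ⟩
    have hlim := tendsto_atTop_ciSup hmono hbdd
    refine cauchy_map_iff_exists_tendsto.1 (Metric.cauchy_iff.2 ⟨inferInstance, fun ε hε => ?_⟩)
    have hpos : 0 < (ε / 2) ^ 2 / (2 * ‖b‖ + 1) := by positivity
    obtain ⟨i₀, hi₀⟩ := (hlim.eventually (lt_mem_nhds (sub_lt_self _ hpos))).exists
    have hd : ∀ i, i₀ ≤ i → dist (f i ξ) (f i₀ ξ) < ε / 2 := by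
      intro i hi
      have h1 := norm_apply_sq_le_of_le (hf hi) (hC i₀ i) ξ
      have h2 : r i - r i₀ < (ε / 2) ^ 2 / (2 * ‖b‖ + 1) := by
        have := le_ciSup hbdd i
        linarith
      have h3 : 0 ≤ r i - r i₀ := sub_nonneg.2 (hmono hi)
      rw [dist_eq_norm]
      refine lt_of_pow_lt_pow_left₀ 2 (by positivity) (h1.trans_lt ?_)
      rw [lt_div_iff₀ (by positivity)] at h2
      calc 2 * ‖b‖ * (r i - r i₀) ≤ (r i - r i₀) * (2 * ‖b‖ + 1) := by linarith
        _ < (ε / 2) ^ 2 := h2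
    refine ⟨_, image_mem_map (Ici_mem_atTop i₀), ?_⟩
    rintro _ ⟨i, hi, rfl⟩ _ ⟨j, hj, rfl⟩
    have := dist_triangle_right (f i ξ) (f j ξ) (f i₀ ξ)
    linarith [hd i hi, hd j hj]
  choose g hg using key
  refine ⟨ofTendstoOfBoundedRange g f (tendsto_pi_nhds.2 hg) ?_, hg⟩
  exact (Metric.isBounded_closedBall (x := (0 : H →L[ℂ] H)) (r := ‖b‖)).subset
    (by rintro _ ⟨i, rfl⟩; simpa using hn i)

variable {ι : Type*} {l : Filter ι} [l.NeBot] {f : ι → H →L[ℂ] H} {g : H →L[ℂ] H}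

theorem isPositive_of_tendsto {H : Type*} [NormedAddCommGroup H] [InnerProductSpace ℂ H]
    {f : ι → H →L[ℂ] H} {g : H →L[ℂ] H} (hg : ∀ ξ, Tendsto (fun i => f i ξ) l (𝓝 (g ξ)))
    (hf : ∀ᶠ i in l, 0 ≤ f i) : 0 ≤ g := by
  rw [nonneg_iff_isPositive, isPositive_def]
  constructor
  · intro ξ η
    refine tendsto_nhds_unique (((hg ξ).inner tendsto_const_nhds)) ?_
    refine (tendsto_const_nhds.inner (hg η)).congr' ?_
    filter_upwards [hf] with i hi
    exact (((nonneg_iff_isPositive _).1 hi).inner_left_eq_inner_right ξ η).symm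
  · intro ξ
    refine ge_of_tendsto
      (RCLike.continuous_re.tendsto _ |>.comp ((hg ξ).inner tendsto_const_nhds)) ?_
    filter_upwards [hf] with i hi
    exact ((nonneg_iff_isPositive _).1 hi).re_inner_nonneg_left ξ

theorem le_of_tendsto_apply (hg : ∀ ξ, Tendsto (fun i => f i ξ) l (𝓝 (g ξ))) {b : H →L[ℂ] H}
    (hf : ∀ᶠ i in l, f i ≤ b) : g ≤ b := by
  rw [← sub_nonneg]
  exact isPositive_of_tendsto (f := fun i => b - f i) (l := l)
    (fun ξ => tendsto_const_nhds.sub (hg ξ)) (hf.mono fun i hi => sub_nonneg.2 hi)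

theorem ge_of_tendsto_apply (hg : ∀ ξ, Tendsto (fun i => f i ξ) l (𝓝 (g ξ))) {b : H →L[ℂ] H}
    (hf : ∀ᶠ i in l, b ≤ f i) : b ≤ g := by
  rw [← sub_nonneg]
  exact isPositive_of_tendsto (f := fun i => f i - b) (l := l)
    (fun ξ => (hg ξ).sub tendsto_const_nhds) (hf.mono fun i hi => sub_nonneg.2 hi)

end ContinuousLinearMap

end StrongLimits

/-! ### Closure properties and order of a von Neumann algebra -/

namespace VonNeumannAlgebra

variable {H : Type*} [NormedAddCommGroup H] [InnerProductSpace ℂ H] [CompleteSpace H]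

theorem mem_iff_forall_commute (M : VonNeumannAlgebra H) (x : H →L[ℂ] H) :
    x ∈ M.toStarSubalgebra ↔ ∀ u ∈ M.commutant, Commute x u := by
  rw [mem_carrier]
  nth_rw 1 [← M.commutant_commutant]
  simp only [SetLike.mem_coe, mem_commutant_iff (S := M.commutant)]
  exact forall₂_congr fun u _ => eq_comm

theorem mem_of_tendsto (M : VonNeumannAlgebra H) {ι : Type*} {l : Filter ι} [l.NeBot]
    {f : ι → H →L[ℂ] H} {g : H →L[ℂ] H} (hg : ∀ ξ, Tendsto (fun i => f i ξ) l (𝓝 (g ξ)))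
    (hf : ∀ i, f i ∈ M.toStarSubalgebra) : g ∈ M.toStarSubalgebra := by
  rw [mem_iff_forall_commute]
  intro u hu
  ext ξ
  refine tendsto_nhds_unique (hg (u ξ)) ?_
  refine ((u.continuous.tendsto _).comp (hg ξ)).congr fun i => ?_
  exact (DFunLike.congr_fun ((M.mem_iff_forall_commute _).1 (hf i) u hu).eq ξ).symm

theorem isClosed_coe (M : VonNeumannAlgebra H) :
    IsClosed (M.toStarSubalgebra : Set (H →L[ℂ] H)) := by
  rw [M.coe_toStarSubalgebra, ← M.centralizer_centralizer]
  exact Set.isClosed_centralizer _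

theorem sqrt_mem (M : VonNeumannAlgebra H) {x : H →L[ℂ] H} (hx : x ∈ M.toStarSubalgebra) :
    CFC.sqrt x ∈ M.toStarSubalgebra := by
  rw [mem_iff_forall_commute] at hx ⊢
  exact fun u hu => (hx u hu).cfcₙ_nnreal _

theorem exists_eq_star_mul_self (M : VonNeumannAlgebra H) {x : M.toStarSubalgebra}
    (hx : 0 ≤ (x : H →L[ℂ] H)) : ∃ y : M.toStarSubalgebra, x = star y * y := by
  refine ⟨⟨CFC.sqrt (x : H →L[ℂ] H), M.sqrt_mem x.2⟩, Subtype.ext ?_⟩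
  simp [(CFC.sqrt_nonneg (x : H →L[ℂ] H)).isSelfAdjoint.star_eq,
    CFC.sqrt_mul_sqrt_self (x : H →L[ℂ] H) hx]

/-- Square roots stay in the algebra, so its intrinsic positive cone is the one induced from `B(H)`.
Together with `isClosed_coe`, this makes the C*-algebraic GNS construction available. -/
theorem starOrderedRing (M : VonNeumannAlgebra H) : StarOrderedRing M.toStarSubalgebra :=
  .of_nonneg_iff' (fun h z => add_le_add_right (show (_ : H →L[ℂ] H) ≤ _ from h) (z : H →L[ℂ] H))
    fun x => ⟨fun h => M.exists_eq_star_mul_self h, by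
      rintro ⟨y, rfl⟩
      exact star_mul_self_nonneg (y : H →L[ℂ] H)⟩

end VonNeumannAlgebra

/-! ### Domination and intertwiners between representations -/

section Representations

variable {A K₁ K₂ : Type*} [Ring A] [StarRing A] [Algebra ℂ A]
  [NormedAddCommGroup K₁] [InnerProductSpace ℂ K₁] [CompleteSpace K₁]
  [NormedAddCommGroup K₂] [InnerProductSpace ℂ K₂] [CompleteSpace K₂]

/-- The orbit map `x ↦ ρ(x) ζ` of a vector under a representation. -/
noncomputable def StarAlgHom.orbitMap (ρ : A →⋆ₐ[ℂ] (K₂ →L[ℂ] K₂)) (ζ : K₂) : A →ₗ[ℂ] K₂ where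
  toFun x := ρ x ζ
  map_add' x y := by simp
  map_smul' c x := by simp

/-- If `π` is dominated by `ρ` on vectors `k`, `ζ`, then some bounded intertwiner from `ρ` to `π`
maps `ζ` to `k`. -/
theorem StarAlgHom.exists_intertwiner (π : A →⋆ₐ[ℂ] (K₁ →L[ℂ] K₁)) (ρ : A →⋆ₐ[ℂ] (K₂ →L[ℂ] K₂))
    {k : K₁} {ζ : K₂} (h : ∀ x, ‖π x k‖ ≤ ‖ρ x ζ‖) :
    ∃ W : K₂ →L[ℂ] K₁, W ζ = k ∧ ∀ x, W ∘L ρ x = π x ∘L W := by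
  -- On the closed cyclic subspace of `ζ`, the hypothesis makes `ρ x ζ ↦ π x k` well defined and
  -- contractive.
  set S : Submodule ℂ K₂ := (LinearMap.range (ρ.orbitMap ζ)).topologicalClosure with hS
  have hmem : ∀ x, ρ x ζ ∈ S := fun x => Submodule.le_topologicalClosure _ ⟨x, rfl⟩
  set e : A →ₗ[ℂ] S := (ρ.orbitMap ζ).codRestrict S hmem with he
  have hdense : DenseRange e := by
    intro y
    rw [Topology.IsEmbedding.subtypeVal.closure_eq_preimage_closure_image]
    have : Subtype.val '' Set.range e = (LinearMap.range (ρ.orbitMap ζ) : Set K₂) := by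
      ext z
      simp only [Set.mem_image, Set.mem_range, exists_exists_eq_and]
      rfl
    rw [Set.mem_preimage, this]
    exact y.2
  have hbound : ∃ C : ℝ, ∀ x, ‖π.orbitMap k x‖ ≤ C * ‖e x‖ := ⟨1, fun x => by
    simpa [he, orbitMap] using h x⟩
  set W₀ := (π.orbitMap k).extendOfNorm e with hW₀
  have hW₀e : ∀ x, W₀ (e x) = π x k := fun x => LinearMap.extendOfNorm_eq hdense hbound x
  have : CompleteSpace S := (Submodule.isClosed_topologicalClosure _).completeSpace_coe
  have hinv : ∀ x, ∀ v ∈ S, ρ x v ∈ S := by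
    intro x v hv
    refine map_mem_closure (ρ x).continuous hv ?_
    rintro _ ⟨y, rfl⟩
    exact ⟨x * y, by simp [orbitMap]⟩
  -- `S` is invariant under a self-adjoint family, so its projection commutes with `ρ`; extending by
  -- zero on the complement therefore still intertwines.
  have hproj : ∀ x v, S.starProjection (ρ x v) = ρ x (S.starProjection v) := by
    intro x v
    refine Submodule.eq_starProjection_of_mem_orthogonal
      (hinv x _ (Submodule.starProjection_apply_mem _ _)) ?_
    rw [← map_sub, Submodule.mem_orthogonal]
    intro u hu
    rw [← ContinuousLinearMap.adjoint_inner_left, ← ContinuousLinearMap.star_eq_adjoint,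
      ← map_star]
    exact (Submodule.mem_orthogonal _ _).1 (S.sub_starProjection_mem_orthogonal v) _
      (hinv _ _ hu)
  have hW₀ρ : ∀ x (v : S), W₀ ⟨ρ x v, hinv x v v.2⟩ = π x (W₀ v) := by
    intro x v
    have hc : Continuous fun v : S => (⟨ρ x v, hinv x v v.2⟩ : S) :=
      ((ρ x).continuous.comp continuous_subtype_val).subtype_mk _
    refine congrFun (hdense.equalizer (W₀.continuous.comp hc)
      ((π x).continuous.comp W₀.continuous) (funext fun y => ?_)) v
    have : (⟨ρ x (e y), hinv x _ (e y).2⟩ : S) = e (x * y) := Subtype.ext (by simp [he, orbitMap])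
    simp only [Function.comp_apply, this, hW₀e, map_mul, mul_apply_eq_comp]
  refine ⟨W₀ ∘L S.orthogonalProjectionOnto, ?_, fun x => ?_⟩
  · have : S.orthogonalProjectionOnto ζ = e 1 := by
      have := Submodule.orthogonalProjectionOnto_mem_subspace_eq_self (e 1)
      simpa [he, orbitMap] using this
    simp [this, hW₀e]
  · ext v
    have : S.orthogonalProjectionOnto (ρ x v) =
        ⟨ρ x (S.orthogonalProjectionOnto v), hinv x _ (Subtype.mem _)⟩ :=
      Subtype.ext (by simpa using! hproj x v)
    simp only [ContinuousLinearMap.comp_apply, this, hW₀ρ]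

/-- A vector state of `π` dominated by one of `ρ` is itself a vector state of `ρ`. -/
theorem StarAlgHom.exists_inner_eq_of_norm_le (π : A →⋆ₐ[ℂ] (K₁ →L[ℂ] K₁))
    (ρ : A →⋆ₐ[ℂ] (K₂ →L[ℂ] K₂)) {k : K₁} {ζ : K₂} (h : ∀ x, ‖π x k‖ ≤ ‖ρ x ζ‖) :
    ∃ ζ' : K₂, ∀ x, ⟪k, π x k⟫_ℂ = ⟪ζ', ρ x ζ'⟫_ℂ := by
  obtain ⟨W, rfl, hW⟩ := StarAlgHom.exists_intertwiner π ρ h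
  -- The Radon–Nikodym derivative `W* W` lies in the commutant of `ρ`, and so does its square root;
  -- the witness is that root applied to `ζ`.
  set T : K₂ →L[ℂ] K₂ := ContinuousLinearMap.adjoint W ∘L W with hT
  have hT0 : 0 ≤ T := (ContinuousLinearMap.nonneg_iff_isPositive _).2
    (ContinuousLinearMap.isPositive_adjoint_comp_self W)
  have hcomm : ∀ x, Commute T (ρ x) := by
    intro x
    have h1 : ContinuousLinearMap.adjoint W ∘L π x = ρ x ∘L ContinuousLinearMap.adjoint W := by
      have := congrArg ContinuousLinearMap.adjoint (hW (star x))
      simp only [ContinuousLinearMap.adjoint_comp, map_star, ContinuousLinearMap.star_eq_adjoint,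
        ContinuousLinearMap.adjoint_adjoint] at this
      exact this.symm
    change ContinuousLinearMap.adjoint W ∘L W ∘L ρ x = ρ x ∘L ContinuousLinearMap.adjoint W ∘L W
    rw [hW x, ← ContinuousLinearMap.comp_assoc, h1, ContinuousLinearMap.comp_assoc]
  set R := CFC.sqrt T with hR
  have hRs : ContinuousLinearMap.adjoint R = R := (CFC.sqrt_nonneg T).isSelfAdjoint.star_eq
  have hRR : R * R = T := CFC.sqrt_mul_sqrt_self T hT0
  refine ⟨R ζ, fun x => ?_⟩
  have hRc : Commute R (ρ x) := (hcomm x).cfcₙ_nnreal _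
  have h2 : R (ρ x (R ζ)) = T (ρ x ζ) := by
    have := DFunLike.congr_fun hRc.eq ζ
    simp only [mul_apply_eq_comp] at this
    rw [← this, ← hRR]
    rfl
  have h3 : π x (W ζ) = W (ρ x ζ) := (DFunLike.congr_fun (hW x) ζ).symm
  rw [h3, ← ContinuousLinearMap.adjoint_inner_right W, ← hRs, ContinuousLinearMap.adjoint_inner_left,
    hRs, h2]
  rfl

/-- Equality at `x = 1` gives `‖ζ'‖ = ‖k‖`, a control that mere domination lacks and that the
summability in `isClosed_normalPart` needs. -/
theorem StarAlgHom.exists_norm_eq_of_norm_le (π : A →⋆ₐ[ℂ] (K₁ →L[ℂ] K₁))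
    (ρ : A →⋆ₐ[ℂ] (K₂ →L[ℂ] K₂)) {k : K₁} {ζ : K₂} (h : ∀ x, ‖π x k‖ ≤ ‖ρ x ζ‖) :
    ∃ ζ' : K₂, ∀ x, ‖π x k‖ = ‖ρ x ζ'‖ := by
  obtain ⟨ζ', hζ'⟩ := StarAlgHom.exists_inner_eq_of_norm_le π ρ h
  refine ⟨ζ', fun x => ?_⟩
  have := hζ' (star x * x)
  simp only [map_mul, map_star, mul_apply_eq_comp, ContinuousLinearMap.star_eq_adjoint,
    ContinuousLinearMap.adjoint_inner_right, inner_self_eq_norm_sq_to_K] at this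
  exact (sq_eq_sq₀ (norm_nonneg _) (norm_nonneg _)).1 (by exact_mod_cast this)

end Representations

/-! ### The amplification to `ℓ²(ℕ, H)` -/

section Amplification

open scoped lp ENNReal

variable {H : Type*} [NormedAddCommGroup H] [InnerProductSpace ℂ H] [CompleteSpace H]

/-- The amplification `x ↦ x ⊗ 1` of `B(H)` to `ℓ²(ℕ, H)`. -/
noncomputable def amplification (H : Type*) [NormedAddCommGroup H] [InnerProductSpace ℂ H]
    [CompleteSpace H] :
    (H →L[ℂ] H) →⋆ₐ[ℂ] (lp (fun _ : ℕ => H) 2 →L[ℂ] lp (fun _ : ℕ => H) 2) where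
  toFun x := lp.mapCLM 2 (fun _ => x) (norm_nonneg x) fun _ => le_rfl
  map_one' := by ext; simp
  map_mul' x y := by ext; simp
  map_zero' := by ext; simp
  map_add' x y := by ext; simp
  commutes' c := by ext; simp [Algebra.algebraMap_eq_smul_one]
  map_star' x := by
    rw [ContinuousLinearMap.star_eq_adjoint, ContinuousLinearMap.star_eq_adjoint,
      ContinuousLinearMap.eq_adjoint_iff]
    intro ξ η
    simp [lp.inner_eq_tsum, ContinuousLinearMap.adjoint_inner_left]

@[simp]
theorem amplification_apply (x : H →L[ℂ] H) (ξ : lp (fun _ : ℕ => H) 2) (n : ℕ) :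
    amplification H x ξ n = x (ξ n) := rfl

theorem inner_amplification (x : H →L[ℂ] H) (ξ η : lp (fun _ : ℕ => H) 2) :
    ⟪η, amplification H x ξ⟫_ℂ = ∑' n, ⟪η n, x (ξ n)⟫_ℂ := lp.inner_eq_tsum _ _

theorem memℓp_two_iff_summable {H : Type*} [NormedAddCommGroup H] {ξ : ℕ → H} :
    Memℓp ξ 2 ↔ Summable fun n => ‖ξ n‖ ^ 2 := by
  rw [memℓp_gen_iff (by simp)]
  simp

theorem hasSum_norm_sq {H : Type*} [NormedAddCommGroup H] (ξ : lp (fun _ : ℕ => H) 2) :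
    HasSum (fun n => ‖ξ n‖ ^ 2) (‖ξ‖ ^ 2) := by
  have := lp.hasSum_norm (p := 2) (by simp) ξ
  simpa using this

/-- A square-summable sequence of vectors of `ℓ²(ℕ, H)` can be rearranged into one vector. -/
theorem exists_hasSum_norm_sq_amplification {ζ : ℕ → lp (fun _ : ℕ => H) 2}
    (hζ : Summable fun n => ‖ζ n‖ ^ 2) :
    ∃ θ : lp (fun _ : ℕ => H) 2, ∀ x : H →L[ℂ] H,
      HasSum (fun n => ‖amplification H x (ζ n)‖ ^ 2) (‖amplification H x θ‖ ^ 2) := by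
  have hs : Summable fun p : ℕ × ℕ => ‖ζ p.1 p.2‖ ^ 2 := by
    refine (summable_prod_of_nonneg fun _ => by positivity).2
      ⟨fun n => (hasSum_norm_sq (ζ n)).summable, ?_⟩
    simpa only [(hasSum_norm_sq (ζ _)).tsum_eq] using hζ
  have hm : Memℓp (fun n => ζ (Nat.pairEquiv.symm n).1 (Nat.pairEquiv.symm n).2) 2 :=
    memℓp_two_iff_summable.2
      ((Nat.pairEquiv.symm.summable_iff (f := fun p : ℕ × ℕ => ‖ζ p.1 p.2‖ ^ 2)).2 hs)
  obtain ⟨θ, hθ⟩ : ∃ θ : lp (fun _ : ℕ => H) 2,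
      ∀ n, θ n = ζ (Nat.pairEquiv.symm n).1 (Nat.pairEquiv.symm n).2 := ⟨⟨_, hm⟩, fun _ => rfl⟩
  refine ⟨θ, fun x => ?_⟩
  have h1 := hasSum_norm_sq (amplification H x θ)
  simp only [amplification_apply, hθ] at h1
  have h2 : HasSum (fun p : ℕ × ℕ => ‖x (ζ p.1 p.2)‖ ^ 2) (‖amplification H x θ‖ ^ 2) :=
    (Nat.pairEquiv.symm.hasSum_iff (f := fun p : ℕ × ℕ => ‖x (ζ p.1 p.2)‖ ^ 2)).1 h1
  exact h2.prod_fiberwise fun n => hasSum_norm_sq (amplification H x (ζ n))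

/-- The vector functionals of the amplification are continuous along bounded strongly convergent
nets. -/
theorem tendsto_inner_amplification {ι : Type*} {l : Filter ι} {f : ι → H →L[ℂ] H}
    {g : H →L[ℂ] H} {C : ℝ} (hg : ∀ ξ, Tendsto (fun i => f i ξ) l (𝓝 (g ξ)))
    (hC : ∀ i, ‖f i‖ ≤ C) (ξ : lp (fun _ : ℕ => H) 2) :
    Tendsto (fun i => ⟪ξ, amplification H (f i) ξ⟫_ℂ) l (𝓝 ⟪ξ, amplification H g ξ⟫_ℂ) := by
  simp only [inner_amplification]
  refine tendsto_tsum_of_dominated_convergence ((hasSum_norm_sq ξ).summable.mul_left C)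
    (fun n => tendsto_const_nhds.inner (hg _)) (Eventually.of_forall fun i n => ?_)
  calc ‖⟪ξ n, f i (ξ n)⟫_ℂ‖ ≤ ‖ξ n‖ * ‖f i (ξ n)‖ := norm_inner_le_norm _ _
    _ ≤ ‖ξ n‖ * (C * ‖ξ n‖) := by gcongr; exact (f i).le_of_opNorm_le (hC i) _
    _ = C * ‖ξ n‖ ^ 2 := by ring

theorem inner_amplification_nonneg {x : H →L[ℂ] H} (hx : 0 ≤ x) (ξ : lp (fun _ : ℕ => H) 2) :
    0 ≤ ⟪ξ, amplification H x ξ⟫_ℂ := by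
  rw [inner_amplification]
  exact tsum_nonneg fun n =>
    ((ContinuousLinearMap.nonneg_iff_isPositive x).1 hx).inner_nonneg_right _

end Amplification

/-! ### GNS vectors and vector states -/

section GNS

variable {A : Type*} [CStarAlgebra A] [PartialOrder A] [StarOrderedRing A]

/-- The cyclic vector of the GNS representation. -/
noncomputable def PositiveLinearMap.gnsVector (ψ : A →ₚ[ℂ] ℂ) : ψ.GNS := (ψ.toPreGNS 1 : ψ.PreGNS)

theorem PositiveLinearMap.gnsStarAlgHom_gnsVector (ψ : A →ₚ[ℂ] ℂ) (a : A) :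
    ψ.gnsStarAlgHom a ψ.gnsVector = (ψ.toPreGNS a : ψ.PreGNS) := by
  simp [gnsVector]

theorem PositiveLinearMap.inner_gnsVector (ψ : A →ₚ[ℂ] ℂ) (a : A) :
    ⟪ψ.gnsVector, ψ.gnsStarAlgHom a ψ.gnsVector⟫_ℂ = ψ a := by
  rw [gnsStarAlgHom_gnsVector]
  simp [gnsVector, preGNS_inner_def]

end GNS

section VectorStates

variable {A K : Type*} [Ring A] [StarRing A] [Algebra ℂ A] [NormedAddCommGroup K]
  [InnerProductSpace ℂ K] [CompleteSpace K] {π : A →⋆ₐ[ℂ] (K →L[ℂ] K)} {Ω : K} {ψ : A → ℂ}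

theorem StarAlgHom.norm_sq_eq_of_inner_eq (hπ : ∀ a, ⟪Ω, π a Ω⟫_ℂ = ψ a) (a : A) :
    ‖π a Ω‖ ^ 2 = (ψ (star a * a)).re := by
  rw [← hπ, map_mul, map_star, mul_apply_eq_comp, ContinuousLinearMap.star_eq_adjoint,
    ContinuousLinearMap.adjoint_inner_right, inner_self_eq_norm_sq_to_K]
  norm_cast

theorem StarAlgHom.norm_sq_mul_eq_of_inner_eq (hπ : ∀ a, ⟪Ω, π a Ω⟫_ℂ = ψ a) (x a : A) :
    ‖π x (π a Ω)‖ ^ 2 = (ψ (star (x * a) * (x * a))).re := by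
  rw [← norm_sq_eq_of_inner_eq hπ, map_mul, mul_apply_eq_comp]

theorem StarAlgHom.dist_sq_eq_of_inner_eq (hπ : ∀ a, ⟪Ω, π a Ω⟫_ℂ = ψ a) (a b : A) :
    dist (π a Ω) (π b Ω) ^ 2 = (ψ (star (a - b) * (a - b))).re := by
  rw [← norm_sq_eq_of_inner_eq hπ, map_sub, sub_apply, dist_eq_norm]

end VectorStates

/-! ### The normal part of a representation -/

namespace VonNeumannAlgebra

open scoped lp ENNReal

variable {H : Type*} [NormedAddCommGroup H] [InnerProductSpace ℂ H] [CompleteSpace H]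

attribute [local instance] isClosed_coe starOrderedRing

/-- The representation of a von Neumann algebra on `ℓ²(ℕ, H)`. -/
noncomputable def amplify (M : VonNeumannAlgebra H) :
    M.toStarSubalgebra →⋆ₐ[ℂ] (lp (fun _ : ℕ => H) 2 →L[ℂ] lp (fun _ : ℕ => H) 2) :=
  (amplification H).comp M.toStarSubalgebra.subtype

theorem amplify_apply (M : VonNeumannAlgebra H) (x : M.toStarSubalgebra) :
    M.amplify x = amplification H x := rfl

variable {M : VonNeumannAlgebra H} {K : Type*} [NormedAddCommGroup K] [InnerProductSpace ℂ K]
  [CompleteSpace K]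

theorem exists_norm_add_norm_le (ζ η : lp (fun _ : ℕ => H) 2) :
    ∃ θ : lp (fun _ : ℕ => H) 2, ∀ x : H →L[ℂ] H,
      ‖amplification H x ζ‖ + ‖amplification H x η‖ ≤ ‖amplification H x θ‖ := by
  have hs : ∀ n ∉ Finset.range 2, (if n = 0 then ζ else if n = 1 then η else 0) = 0 := by
    intro n hn
    have : ¬ n < 2 := fun h => hn (Finset.mem_range.2 h)
    simp [show n ≠ 0 by omega, show n ≠ 1 by omega]
  obtain ⟨θ, hθ⟩ := exists_hasSum_norm_sq_amplification
    (ζ := fun n => if n = 0 then ζ else if n = 1 then η else 0)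
    (summable_of_ne_finset_zero (s := Finset.range 2) fun n hn => by rw [hs n hn]; simp)
  -- `(a + b)² ≤ 4 (a² + b²)`; the factor `√2` would suffice, but `2` avoids a root.
  refine ⟨(2 : ℂ) • θ, fun x => ?_⟩
  have h1 := (hθ x).unique (hasSum_sum_of_ne_finset_zero (s := Finset.range 2)
    fun n hn => by rw [hs n hn]; simp)
  simp [Finset.sum_range_succ] at h1
  rw [map_smul, norm_smul, Complex.norm_ofNat]
  refine le_of_sq_le_sq ?_ (by positivity)
  rw [mul_pow, h1]
  nlinarith [sq_nonneg (‖amplification H x ζ‖ - ‖amplification H x η‖),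
    sq_nonneg ‖amplification H x ζ‖, sq_nonneg ‖amplification H x η‖]

/-- The normal part of a representation: the vectors whose vector state is dominated by a vector
state of the amplification. -/
noncomputable def normalPart (π : M.toStarSubalgebra →⋆ₐ[ℂ] (K →L[ℂ] K)) : Submodule ℂ K where
  carrier := {k | ∃ ζ, ∀ x, ‖π x k‖ ≤ ‖M.amplify x ζ‖}
  zero_mem' := ⟨0, by simp⟩
  add_mem' := by
    rintro k l ⟨ζ, hζ⟩ ⟨η, hη⟩
    obtain ⟨θ, hθ⟩ := exists_norm_add_norm_le ζ η
    refine ⟨θ, fun x => ?_⟩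
    rw [map_add]
    exact (norm_add_le _ _).trans ((add_le_add (hζ x) (hη x)).trans (hθ x))
  smul_mem' := by
    rintro c k ⟨ζ, hζ⟩
    refine ⟨c • ζ, fun x => ?_⟩
    rw [map_smul, map_smul, norm_smul, norm_smul]
    exact mul_le_mul_of_nonneg_left (hζ x) (norm_nonneg c)

theorem mem_normalPart {π : M.toStarSubalgebra →⋆ₐ[ℂ] (K →L[ℂ] K)} {k : K} :
    k ∈ normalPart π ↔ ∃ ζ, ∀ x, ‖π x k‖ ≤ ‖M.amplify x ζ‖ := Iff.rfl

/-- A limit vector is a rapidly convergent series of `d n` in the subspace, each with the orbit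
norms of some `ζ n`. Cauchy–Schwarz with weights `(2/3)^n`, of total mass `3`, bounds `‖π x k‖²` by
`∑ 3 (3/2)^n ‖π x (d n)‖²`. The rescaled `ζ n` are square-summable, so they merge into one
dominating vector. -/
theorem isClosed_normalPart (π : M.toStarSubalgebra →⋆ₐ[ℂ] (K →L[ℂ] K)) :
    IsClosed (normalPart π : Set K) := by
  refine isClosed_of_closure_subset fun k hk => ?_
  obtain ⟨d, hlim, hd, -, hdn⟩ := controlled_sum_of_mem_closure (s := (normalPart π).toAddSubgroup)
    (a := k) hk (b := fun n => (1 / 2 : ℝ) ^ n) fun n => by positivity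
  have hex : ∀ n, ∃ ζ, ∀ x, ‖π x (d n)‖ = ‖M.amplify x ζ‖ := fun n => by
    obtain ⟨ζ, hζ⟩ := mem_normalPart.1 (hd n)
    exact StarAlgHom.exists_norm_eq_of_norm_le π M.amplify hζ
  choose ζ hζ using hex
  have hζn : ∀ n, ‖ζ n‖ = ‖d n‖ := fun n => by simpa using (hζ n 1).symm
  have hsq : ∀ (n : ℕ) (v : lp (fun _ : ℕ => H) 2),
      ‖((√(3 * (3 / 2) ^ n) : ℝ) : ℂ) • v‖ ^ 2 = 3 * (3 / 2) ^ n * ‖v‖ ^ 2 := fun n v => by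
    rw [norm_smul, mul_pow, Complex.norm_real, Real.norm_eq_abs, sq_abs,
      Real.sq_sqrt (by positivity)]
  obtain ⟨θ, hθ⟩ := exists_hasSum_norm_sq_amplification
    (ζ := fun n => ((√(3 * (3 / 2) ^ n) : ℝ) : ℂ) • ζ n) (by
      -- The bound `‖d n‖ < 2⁻ⁿ` holds only for `n > 0`, so the first term is dropped.
      rw [← summable_nat_add_iff 1]
      refine Summable.of_nonneg_of_le (fun _ => by positivity) (fun n => ?_)
        ((summable_geometric_of_lt_one (r := 3 / 8) (by norm_num) (by norm_num)).mul_left (9 / 8))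
      rw [hsq, hζn]
      have := hdn (n + 1) n.succ_pos
      calc 3 * (3 / 2) ^ (n + 1) * ‖d (n + 1)‖ ^ 2
          ≤ 3 * (3 / 2) ^ (n + 1) * ((1 / 2 : ℝ) ^ (n + 1)) ^ 2 := by gcongr
        _ = 9 / 8 * (3 / 8) ^ n := by
          rw [← pow_mul, mul_comm (n + 1) 2, pow_mul, mul_assoc, ← mul_pow]
          norm_num [pow_succ]
          ring)
  refine mem_normalPart.2 ⟨θ, fun x => ?_⟩
  have hlim' : Tendsto (fun n => ‖∑ i ∈ Finset.range (n + 1), π x (d i)‖) atTop (𝓝 ‖π x k‖) := by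
    simpa only [Function.comp_def, map_sum] using (((π x).continuous.tendsto _).comp hlim).norm
  refine le_of_tendsto' hlim' fun n => ?_
  refine le_of_sq_le_sq ?_ (norm_nonneg _)
  have hgeo : ∑ i ∈ Finset.range (n + 1), (2 / 3 : ℝ) ^ i ≤ 3 := by
    have := (summable_geometric_of_lt_one (r := (2 / 3 : ℝ)) (by norm_num) (by norm_num)).sum_le_tsum
      (Finset.range (n + 1)) (fun _ _ => by positivity)
    rw [tsum_geometric_of_lt_one (by norm_num) (by norm_num)] at this
    exact this.trans_eq (by norm_num)
  calc ‖∑ i ∈ Finset.range (n + 1), π x (d i)‖ ^ 2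
      ≤ (∑ i ∈ Finset.range (n + 1), ‖π x (d i)‖) ^ 2 := by gcongr; exact norm_sum_le _ _
    _ ≤ (∑ i ∈ Finset.range (n + 1), (2 / 3 : ℝ) ^ i) *
          ∑ i ∈ Finset.range (n + 1), (3 / 2 : ℝ) ^ i * ‖π x (d i)‖ ^ 2 :=
        Finset.sum_sq_le_sum_mul_sum_of_sq_le_mul _ (fun _ _ => by positivity)
          (fun _ _ => by positivity) fun i _ => by
            rw [← mul_assoc, ← mul_pow]; norm_num
    _ ≤ 3 * ∑ i ∈ Finset.range (n + 1), (3 / 2 : ℝ) ^ i * ‖π x (d i)‖ ^ 2 := by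
        gcongr
    _ = ∑ i ∈ Finset.range (n + 1),
          ‖amplification H x (((√(3 * (3 / 2) ^ i) : ℝ) : ℂ) • ζ i)‖ ^ 2 := by
        rw [Finset.mul_sum]
        refine Finset.sum_congr rfl fun i _ => ?_
        rw [map_smul, hsq, hζ, amplify_apply]
        ring
    _ ≤ ‖M.amplify x θ‖ ^ 2 := sum_le_hasSum _ (fun _ _ => by positivity) (hθ x)

/-! ### Order-continuous positive functionals -/

variable {π : M.toStarSubalgebra →⋆ₐ[ℂ] (K →L[ℂ] K)} {Ω : K}

/-- A nonempty chain of positive elements of a von Neumann algebra which is bounded above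
converges strongly to an upper bound. -/
theorem exists_sup_of_isChain {c : Set M.toStarSubalgebra} (hc : IsChain (· ≤ ·) c)
    (hne : c.Nonempty) (h0 : ∀ x ∈ c, 0 ≤ x) {b : M.toStarSubalgebra} (hb : ∀ x ∈ c, x ≤ b) :
    ∃ g : M.toStarSubalgebra, (∀ x ∈ c, x ≤ g) ∧ g ≤ b ∧
      ∀ ξ, Tendsto (fun i : c => (i : H →L[ℂ] H) ξ) atTop (𝓝 ((g : H →L[ℂ] H) ξ)) := by
  have : Nonempty c := hne.to_subtype
  have : IsDirectedOrder c := hc.isDirectedOrder_coe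
  obtain ⟨g, hg⟩ := ContinuousLinearMap.exists_tendsto_of_monotone
    (f := fun i : c => ((i : M.toStarSubalgebra) : H →L[ℂ] H)) (fun i j h => h)
    (fun i => h0 i i.2) (b := b) fun i => hb i i.2
  refine ⟨⟨g, M.mem_of_tendsto hg fun i => i.1.2⟩, fun x hx => ?_, ?_, hg⟩
  · exact ContinuousLinearMap.ge_of_tendsto_apply hg
      ((eventually_ge_atTop (⟨x, hx⟩ : c)).mono fun i hi => hi)
  · exact ContinuousLinearMap.le_of_tendsto_apply hg (Eventually.of_forall fun i => hb i i.2)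

theorem exists_lt_re_inner {h : H →L[ℂ] H} (h0 : 0 ≤ h) (hne : h ≠ 0) (r : ℝ) :
    ∃ ζ : H, r < (⟪ζ, h ζ⟫_ℂ).re := by
  obtain ⟨ξ, hξ⟩ : ∃ ξ, h ξ ≠ 0 := by
    by_contra! hcon
    exact hne (ContinuousLinearMap.ext hcon)
  have hpos : 0 < (⟪ξ, h ξ⟫_ℂ).re := by
    have h1 := ContinuousLinearMap.norm_apply_sq_le_of_nonneg h0 ξ
    have h2 : 0 < ‖h ξ‖ ^ 2 := by positivity
    exact pos_of_mul_pos_right (h2.trans_le h1) (norm_nonneg h)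
  obtain ⟨n, hn⟩ := exists_nat_gt (r / (⟪ξ, h ξ⟫_ℂ).re)
  refine ⟨((n + 1 : ℕ) : ℂ) • ξ, ?_⟩
  rw [div_lt_iff₀ hpos] at hn
  have : (⟪((n + 1 : ℕ) : ℂ) • ξ, h (((n + 1 : ℕ) : ℂ) • ξ)⟫_ℂ).re =
      (n + 1) ^ 2 * (⟪ξ, h ξ⟫_ℂ).re := by
    rw [map_smul, inner_smul_left, inner_smul_right, ← mul_assoc, Complex.conj_natCast,
      ← Nat.cast_mul, ← Complex.ofReal_natCast, Complex.re_ofReal_mul]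
    push_cast
    ring
  rw [this]
  have hn0 : (0 : ℝ) ≤ n := n.cast_nonneg
  calc r < n * (⟪ξ, h ξ⟫_ℂ).re := hn
    _ ≤ (n + 1) ^ 2 * (⟪ξ, h ξ⟫_ℂ).re := by gcongr; nlinarith

/-- Below a nonzero positive element there is a nonzero positive element on which a given positive
functional is dominated by a vector functional. -/
theorem exists_forall_le_re_inner (ψ : M.toStarSubalgebra →ₚ[ℂ] ℂ) {h : M.toStarSubalgebra}
    (h0 : 0 ≤ h) (hne : h ≠ 0) :
    ∃ (a : M.toStarSubalgebra) (ζ : H), 0 ≤ a ∧ a ≤ h ∧ a ≠ 0 ∧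
      ∀ y, 0 ≤ y → y ≤ a → (ψ y).re ≤ (⟪ζ, (y : H →L[ℂ] H) ζ⟫_ℂ).re := by
  obtain ⟨ζ, hζ⟩ := exists_lt_re_inner (h := (h : H →L[ℂ] H)) h0
    (fun h' => hne (Subtype.ext h')) (ψ h).re
  have hψ : ∀ {x y : M.toStarSubalgebra}, x ≤ y → (ψ x).re ≤ (ψ y).re := fun hxy =>
    (Complex.le_def.1 (OrderHomClass.mono ψ hxy)).1
  -- A maximal `m` in `S` absorbs the part of `h` where the vector functional stays below `ψ`. Any
  -- `y ≤ h - m` violating the claim could be added to `m`, and `h - m ≠ 0` because `ζ` was chosen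
  -- to beat `ψ` at `h`.
  set S : Set M.toStarSubalgebra :=
    {x | 0 ≤ x ∧ x ≤ h ∧ (⟪ζ, (x : H →L[ℂ] H) ζ⟫_ℂ).re ≤ (ψ x).re} with hS
  obtain ⟨m, hm⟩ := zorn_le₀ S fun c hcS hc => by
    rcases c.eq_empty_or_nonempty with rfl | hcne
    · exact ⟨0, ⟨le_rfl, h0, by simp⟩, by simp⟩
    obtain ⟨g, hcg, hgh, hg⟩ := exists_sup_of_isChain hc hcne (fun x hx => (hcS hx).1)
      (b := h) fun x hx => (hcS hx).2.1
    have : Nonempty c := hcne.to_subtype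
    have : IsDirectedOrder c := hc.isDirectedOrder_coe
    obtain ⟨x, hx⟩ := hcne
    refine ⟨g, ⟨(hcS hx).1.trans (hcg x hx), hgh, ?_⟩, hcg⟩
    -- The vector functional passes to the strong limit; for `ψ` monotonicity is enough, so no
    -- continuity of `ψ` enters.
    refine le_of_tendsto' ((Complex.continuous_re.tendsto _).comp
      (tendsto_const_nhds.inner (hg ζ))) fun i => ?_
    exact (hcS i.2).2.2.trans (hψ (hcg i i.2))
  obtain ⟨hm0, hmh, hmζ⟩ := hm.prop
  refine ⟨h - m, ζ, sub_nonneg.2 hmh, sub_le_self h hm0, fun heq => ?_, fun y hy0 hyh => ?_⟩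
  · rw [sub_eq_zero] at heq
    rw [← heq] at hmζ
    exact hζ.not_ge hmζ
  · by_contra! hlt
    have hmem : m + y ∈ S := by
      refine ⟨add_nonneg hm0 hy0, by simpa using add_le_add_right hyh m, ?_⟩
      have : ((m + y : M.toStarSubalgebra) : H →L[ℂ] H) ζ = (m : H →L[ℂ] H) ζ + (y : H →L[ℂ] H) ζ :=
        rfl
      rw [this, inner_add_right, map_add, Complex.add_re, Complex.add_re]
      exact add_le_add hmζ hlt.le
    have hle : m + y ≤ m := hm.le_of_ge hmem (le_add_of_nonneg_right hy0)
    have hy : y = 0 := le_antisymm (by simpa using hle) hy0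
    simp [hy] at hlt

theorem norm_amplification_single (x : H →L[ℂ] H) (η : H) :
    ‖amplification H x (lp.single 2 0 η)‖ = ‖x η‖ := by
  have : amplification H x (lp.single 2 0 η) = lp.single 2 0 (x η) := by
    ext n
    rw [amplification_apply]
    by_cases hn : n = 0
    · subst hn; simp
    · simp [lp.single_apply, hn]
  rw [this, lp.norm_single (by simp)]

/-- Domination of `ψ` on `[0, a]` by the vector functional of `ζ` extends to all `(x a)* (x a)`, so
`‖π x (π a Ω)‖ ≤ ‖x a ζ‖`; the vector `a ζ` placed in one coordinate dominates. -/
theorem exists_apply_mem_normalPart {ψ : M.toStarSubalgebra →ₚ[ℂ] ℂ}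
    (hπ : ∀ a, ⟪Ω, π a Ω⟫_ℂ = ψ a) {h : M.toStarSubalgebra} (h0 : 0 ≤ h) (hne : h ≠ 0) :
    ∃ a : M.toStarSubalgebra, 0 ≤ a ∧ a ≤ h ∧ a ≠ 0 ∧
      π a Ω ∈ normalPart π := by
  obtain ⟨a, ζ, ha0, hah, hane, hψ⟩ := exists_forall_le_re_inner ψ h0 hne
  refine ⟨a, ha0, hah, hane, mem_normalPart.2 ⟨lp.single 2 0 ((a : H →L[ℂ] H) ζ), fun x => ?_⟩⟩
  refine le_of_sq_le_sq ?_ (norm_nonneg _)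
  rw [amplify_apply, norm_amplification_single, StarAlgHom.norm_sq_mul_eq_of_inner_eq hπ]
  obtain ⟨C, y, hC, hy0, hya, hy⟩ := CStarAlgebra.exists_star_mul_self_mul_eq_smul ha0 x
  have hinner : ((‖(x : H →L[ℂ] H) ((a : H →L[ℂ] H) ζ)‖ ^ 2 : ℝ) : ℂ) =
      C * ⟪ζ, (y : H →L[ℂ] H) ζ⟫_ℂ := by
    have : star ((x : H →L[ℂ] H) * (a : H →L[ℂ] H)) * ((x : H →L[ℂ] H) * (a : H →L[ℂ] H)) =
        (C : ℂ) • (y : H →L[ℂ] H) := congrArg Subtype.val hy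
    rw [← inner_smul_right, ← smul_apply, ← this, mul_apply_eq_comp,
      ContinuousLinearMap.star_eq_adjoint, ContinuousLinearMap.adjoint_inner_right, mul_apply_eq_comp,
      inner_self_eq_norm_sq_to_K]
    norm_cast
  have hinner' := congrArg Complex.re hinner
  rw [Complex.ofReal_re, Complex.re_ofReal_mul] at hinner'
  rw [hy, map_smul, smul_eq_mul, Complex.re_ofReal_mul, hinner']
  exact mul_le_mul_of_nonneg_left (hψ y hy0 hya) hC

/-- A positive functional which is continuous along increasing chains is a vector functional of the
amplification. -/
theorem exists_eq_inner_amplify_of_inner_eq {ψ : M.toStarSubalgebra →ₚ[ℂ] ℂ}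
    (hπ : ∀ a, ⟪Ω, π a Ω⟫_ℂ = ψ a)
    (hψ : ∀ (c : Set M.toStarSubalgebra), IsChain (· ≤ ·) c → c.Nonempty →
      c ⊆ Set.Icc 0 1 → ∀ g : M.toStarSubalgebra,
      (∀ ξ, Tendsto (fun i : c => (i : H →L[ℂ] H) ξ) atTop (𝓝 ((g : H →L[ℂ] H) ξ))) →
      ∀ ε > 0, ∃ x ∈ c, (ψ (g - x)).re ≤ ε) :
    ∃ ζ : lp (fun _ : ℕ => H) 2, ∀ x, ψ x = ⟪ζ, M.amplify x ζ⟫_ℂ := by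
  set T : Set M.toStarSubalgebra := {h | 0 ≤ h ∧ h ≤ 1 ∧ π h Ω ∈ normalPart π} with hT
  have hψm : ∀ {x y : M.toStarSubalgebra}, x ≤ y → (ψ x).re ≤ (ψ y).re := fun hxy =>
    (Complex.le_def.1 (OrderHomClass.mono ψ hxy)).1
  obtain ⟨m, hm⟩ := zorn_le₀ T fun c hcT hc => by
    rcases c.eq_empty_or_nonempty with rfl | hcne
    · exact ⟨0, ⟨le_rfl, zero_le_one, by simp⟩, by simp⟩
    obtain ⟨g, hcg, hg1, hg⟩ := exists_sup_of_isChain hc hcne (fun x hx => (hcT hx).1)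
      (b := 1) fun x hx => (hcT hx).2.1
    obtain ⟨x₀, hx₀⟩ := id hcne
    refine ⟨g, ⟨(hcT hx₀).1.trans (hcg x₀ hx₀), hg1, ?_⟩, hcg⟩
    -- Order continuity enters here: `‖π (g - x) Ω‖² = ψ ((g - x)²) ≤ ψ (g - x)`, because `0 ≤ g - x
    -- ≤ 1`.
    refine (isClosed_normalPart π).closure_subset (Metric.mem_closure_iff.2 fun ε hε => ?_)
    obtain ⟨x, hx, hxε⟩ := hψ c hc hcne (fun x hx => ⟨(hcT hx).1, (hcT hx).2.1⟩) g hg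
      ((ε / 2) ^ 2) (by positivity)
    refine ⟨_, (hcT hx).2.2, ?_⟩
    have hd0 : 0 ≤ g - x := sub_nonneg.2 (hcg x hx)
    have hd1 : g - x ≤ 1 := (sub_le_self g (hcT hx).1).trans hg1
    have hdd := CStarAlgebra.mul_self_le_self hd0 hd1
    refine lt_of_le_of_lt (le_of_sq_le_sq ?_ (by positivity)) (half_lt_self hε)
    rw [StarAlgHom.dist_sq_eq_of_inner_eq hπ, hd0.isSelfAdjoint.star_eq]
    exact (hψm hdd).trans hxε
  obtain ⟨hm0, hm1, hmn⟩ := hm.prop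
  have hm_eq : m = 1 := by
    by_contra hne
    obtain ⟨a, ha0, ha1, hane, han⟩ := exists_apply_mem_normalPart hπ (h := 1 - m)
      (sub_nonneg.2 hm1) (sub_ne_zero.2 (Ne.symm hne))
    have hmem : m + a ∈ T := by
      refine ⟨add_nonneg hm0 ha0, by simpa using add_le_add_right ha1 m, ?_⟩
      rw [map_add, add_apply]
      exact add_mem hmn han
    have hle : m + a ≤ m := hm.le_of_ge hmem (le_add_of_nonneg_right ha0)
    exact hane (le_antisymm (by simpa using hle) ha0)
  rw [hm_eq, map_one] at hmn
  obtain ⟨ζ, hζ⟩ := mem_normalPart.1 hmn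
  obtain ⟨ζ', hζ'⟩ := StarAlgHom.exists_inner_eq_of_norm_le π M.amplify hζ
  exact ⟨ζ', fun x => by rw [← hζ' x]; exact (hπ x).symm⟩

variable {N : VonNeumannAlgebra H}

/-- A positive functional which is continuous along increasing chains is a vector functional of the
amplification. -/
theorem exists_eq_inner_amplify (ψ : M.toStarSubalgebra →ₚ[ℂ] ℂ)
    (hψ : ∀ (c : Set M.toStarSubalgebra), IsChain (· ≤ ·) c → c.Nonempty →
      c ⊆ Set.Icc 0 1 → ∀ g : M.toStarSubalgebra,
      (∀ ξ, Tendsto (fun i : c => (i : H →L[ℂ] H) ξ) atTop (𝓝 ((g : H →L[ℂ] H) ξ))) →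
      ∀ ε > 0, ∃ x ∈ c, (ψ (g - x)).re ≤ ε) :
    ∃ ζ : lp (fun _ : ℕ => H) 2, ∀ x, ψ x = ⟪ζ, M.amplify x ζ⟫_ℂ :=
  exists_eq_inner_amplify_of_inner_eq ψ.inner_gnsVector hψ

/-! ### Order continuity from the Pimsner–Popa inequality -/

namespace IsConditionalExpectation

variable {hNM : N ≤ M} {E F : M.toStarSubalgebra →ₗ[ℂ] N.toStarSubalgebra}

theorem mono (hE : IsConditionalExpectation hNM E) {x y : M.toStarSubalgebra} (h : x ≤ y) :
    (E x : H →L[ℂ] H) ≤ E y := by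
  have := hE.nonneg (y - x) (sub_nonneg.2 (show (x : H →L[ℂ] H) ≤ y from h))
  rw [map_sub] at this
  exact sub_nonneg.1 this

theorem apply_one (hE : IsConditionalExpectation hNM E) : E 1 = 1 := hE.apply_of_mem 1

theorem pimsnerPopa_of_nonneg {c : ℝ} (hPP : PimsnerPopaInequality E c)
    {x : M.toStarSubalgebra} (hx : 0 ≤ (x : H →L[ℂ] H)) :
    (c : ℂ) • (x : H →L[ℂ] H) ≤ E x := by
  obtain ⟨y, rfl⟩ := M.exists_eq_star_mul_self hx
  exact hPP y

/-- If `E` satisfies the Pimsner–Popa inequality, then for every conditional expectation `F` and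
every increasing chain with supremum `g`, the elements `F (g - x)` are dominated by multiples of
`s - E x`, where `s` is the strong limit of the image of the chain under `E`. -/
theorem exists_forall_smul_apply_sub_le (hE : IsConditionalExpectation hNM E)
    (hF : IsConditionalExpectation hNM F) {c : ℝ} (hPP : PimsnerPopaInequality E c)
    {C : Set M.toStarSubalgebra} (hC : IsChain (· ≤ ·) C) (hne : C.Nonempty)
    (hC1 : C ⊆ Set.Icc 0 1) {g : M.toStarSubalgebra}
    (hg : ∀ ξ, Tendsto (fun i : C => (i : H →L[ℂ] H) ξ) atTop (𝓝 ((g : H →L[ℂ] H) ξ))) :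
    ∃ s : H →L[ℂ] H, (∀ ξ, Tendsto (fun i : C => (E i : H →L[ℂ] H) ξ) atTop (𝓝 (s ξ))) ∧
      ∀ x ∈ C, (c : ℂ) • (F (g - x) : H →L[ℂ] H) ≤ s - E x := by
  have : Nonempty C := hne.to_subtype
  have : IsDirectedOrder C := hC.isDirectedOrder_coe
  have hE1 : ∀ i : C, (E i : H →L[ℂ] H) ≤ 1 := fun i => by
    have := hE.mono (hC1 i.2).2
    rwa [hE.apply_one] at this
  obtain ⟨s, hs⟩ := ContinuousLinearMap.exists_tendsto_of_monotone
    (f := fun i : C => (E i : H →L[ℂ] H)) (fun i j h => hE.mono h)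
    (fun i => hE.nonneg _ (hC1 i.2).1) hE1
  have hsN : s ∈ N.toStarSubalgebra := N.mem_of_tendsto hs fun i => (E i).2
  refine ⟨s, hs, fun x hx => ?_⟩
  -- With `x` fixed, `c (i - x) ≤ E i - E x ≤ s - E x` for later `i`; only the left side is passed
  -- to the limit, so `E` needs no continuity.
  have h1 : (c : ℂ) • ((g : H →L[ℂ] H) - x) ≤ s - E x := by
    refine ContinuousLinearMap.le_of_tendsto_apply (l := atTop)
      (f := fun i : C => (c : ℂ) • ((i : H →L[ℂ] H) - (x : H →L[ℂ] H)))
      (fun ξ => ((hg ξ).sub tendsto_const_nhds).const_smul (c : ℂ)) ?_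
    filter_upwards [eventually_ge_atTop (⟨x, hx⟩ : C)] with i hi
    have h2 : (c : ℂ) • (((i : M.toStarSubalgebra) - x : M.toStarSubalgebra) : H →L[ℂ] H) ≤
        E ((i : M.toStarSubalgebra) - x) :=
      pimsnerPopa_of_nonneg hPP (sub_nonneg.2 (show (x : H →L[ℂ] H) ≤ i from hi))
    rw [map_sub] at h2
    refine h2.trans (sub_le_sub_right ?_ _)
    exact ContinuousLinearMap.ge_of_tendsto_apply hs
      ((eventually_ge_atTop i).mono fun j hj => hE.mono hj)
  -- The upper bound is viewed in `M` as an element of `N`, so that `F` fixes it.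
  have h3 : (c : ℂ) • (g - x) ≤
      (⟨((⟨s, hsN⟩ - E x : N.toStarSubalgebra) : H →L[ℂ] H), hNM (Subtype.mem _)⟩ :
        M.toStarSubalgebra) := h1
  have h4 := hF.mono h3
  rw [hF.apply_of_mem, map_smul] at h4
  exact h4

end IsConditionalExpectation

/-- The positive functional `x ↦ ⟪ξ, (F x ⊗ 1) ξ⟫` attached to a positive map `F`. -/
noncomputable def vectorFunctional (F : M.toStarSubalgebra →ₗ[ℂ] N.toStarSubalgebra)
    (hF : ∀ x : M.toStarSubalgebra, 0 ≤ (x : H →L[ℂ] H) → 0 ≤ (F x : H →L[ℂ] H))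
    (ξ : lp (fun _ : ℕ => H) 2) : M.toStarSubalgebra →ₚ[ℂ] ℂ :=
  PositiveLinearMap.mk₀
    { toFun := fun x => ⟪ξ, N.amplify (F x) ξ⟫_ℂ
      map_add' := fun x y => by rw [map_add, map_add, add_apply, inner_add_right]
      map_smul' := fun c x => by
        rw [map_smul, map_smul, smul_apply, inner_smul_right, smul_eq_mul, RingHom.id_apply] }
    fun x hx => inner_amplification_nonneg (hF x hx) ξ

theorem vectorFunctional_apply (F : M.toStarSubalgebra →ₗ[ℂ] N.toStarSubalgebra)
    (hF : ∀ x : M.toStarSubalgebra, 0 ≤ (x : H →L[ℂ] H) → 0 ≤ (F x : H →L[ℂ] H))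
    (ξ : lp (fun _ : ℕ => H) 2) (x : M.toStarSubalgebra) :
    vectorFunctional F hF ξ x = ⟪ξ, amplification H (F x) ξ⟫_ℂ := rfl

theorem IsConditionalExpectation.exists_inner_eq {hNM : N ≤ M}
    {E F : M.toStarSubalgebra →ₗ[ℂ] N.toStarSubalgebra} (hE : IsConditionalExpectation hNM E)
    (hF : IsConditionalExpectation hNM F) {c : ℝ} (hc : 0 < c) (hPP : PimsnerPopaInequality E c)
    (ξ : lp (fun _ : ℕ => H) 2) :
    ∃ ζ : lp (fun _ : ℕ => H) 2, ∀ x : M.toStarSubalgebra,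
      ⟪ξ, amplification H (F x) ξ⟫_ℂ = ⟪ζ, amplification H x ζ⟫_ℂ := by
  refine exists_eq_inner_amplify (vectorFunctional F hF.nonneg ξ) fun C hC hne hC1 g hg ε hε => ?_
  obtain ⟨s, hs, hle⟩ := hE.exists_forall_smul_apply_sub_le hF hPP hC hne hC1 hg
  have : Nonempty C := hne.to_subtype
  have : IsDirectedOrder C := hC.isDirectedOrder_coe
  have hlim := tendsto_inner_amplification (C := ‖(1 : H →L[ℂ] H)‖) hs (fun i => by
    refine CStarAlgebra.norm_le_norm_of_nonneg_of_le (hE.nonneg _ (hC1 i.2).1) ?_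
    have := hE.mono (hC1 i.2).2
    rwa [hE.apply_one] at this) ξ
  have hlim' := (Complex.continuous_re.tendsto _).comp hlim
  obtain ⟨i, hi⟩ := (hlim'.eventually (lt_mem_nhds
    (sub_lt_self (⟪ξ, amplification H s ξ⟫_ℂ).re (mul_pos hc hε)))).exists
  refine ⟨i, i.2, ?_⟩
  have h1 := inner_amplification_nonneg (sub_nonneg.2 (hle i i.2)) ξ
  rw [map_sub, map_sub, map_smul, sub_apply, sub_apply, smul_apply, inner_sub_right,
    inner_sub_right, inner_smul_right] at h1
  have h2 := (Complex.le_def.1 h1).1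
  rw [Complex.sub_re, Complex.sub_re, Complex.re_ofReal_mul, Complex.zero_re] at h2
  rw [vectorFunctional_apply]
  simp only [Function.comp_apply] at hi
  exact le_of_mul_le_mul_left (by linarith) hc

/-! ### Passage to the σ-weak topology -/

theorem continuous_inner_amplification (ζ : lp (fun _ : ℕ => H) 2) :
    @Continuous _ _ M.sigmaWeak _ fun x : M.toStarSubalgebra => ⟪ζ, amplification H x ζ⟫_ℂ := by
  have hζ : Summable fun n => ‖ζ n‖ ^ 2 := (hasSum_norm_sq ζ).summable
  simp only [inner_amplification]
  let _ : TopologicalSpace M.toStarSubalgebra := M.sigmaWeak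
  let _ : TopologicalSpace (H →L[ℂ] H) := sigmaWeakTopology H
  have h1 : Continuous fun x : H →L[ℂ] H => ∑' n, ⟪ζ n, x (ζ n)⟫_ℂ :=
    continuous_iInf_dom (i := fun n => ζ n) <| continuous_iInf_dom (i := fun n => ζ n) <|
      continuous_iInf_dom (i := hζ) <| continuous_iInf_dom (i := hζ) continuous_induced_dom
  exact h1.comp continuous_induced_dom

theorem inner_amplification_polarization (x : H →L[ℂ] H) (ξ η : lp (fun _ : ℕ => H) 2) :
    ⟪η, amplification H x ξ⟫_ℂ =
      (⟪η + ξ, amplification H x (η + ξ)⟫_ℂ - ⟪η - ξ, amplification H x (η - ξ)⟫_ℂ -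
        Complex.I * ⟪η + Complex.I • ξ, amplification H x (η + Complex.I • ξ)⟫_ℂ +
        Complex.I * ⟪η - Complex.I • ξ, amplification H x (η - Complex.I • ξ)⟫_ℂ) / 4 := by
  simp only [map_add, map_sub, map_smul, inner_add_left, inner_add_right, inner_sub_left,
    inner_sub_right, inner_smul_left, inner_smul_right, Complex.conj_I]
  linear_combination (1 / 2 * ⟪η, amplification H x ξ⟫_ℂ - 1 / 2 * ⟪ξ, amplification H x η⟫_ℂ) *
    Complex.I_sq

/-- A linear map is normal as soon as its compositions with the vector functionals of the
amplification are σ-weakly continuous. -/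
theorem isNormalMap_of_continuous_inner (F : M.toStarSubalgebra →ₗ[ℂ] N.toStarSubalgebra)
    (h : ∀ ξ : lp (fun _ : ℕ => H) 2, @Continuous _ _ M.sigmaWeak _
      fun x : M.toStarSubalgebra => ⟪ξ, amplification H (F x) ξ⟫_ℂ) :
    IsNormalMap F := by
  let _ : TopologicalSpace M.toStarSubalgebra := M.sigmaWeak
  refine continuous_induced_rng.2 (continuous_iInf_rng.2 fun ξ => continuous_iInf_rng.2 fun η =>
    continuous_iInf_rng.2 fun hξ => continuous_iInf_rng.2 fun hη => continuous_induced_rng.2 ?_)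
  obtain ⟨ξ, rfl⟩ : ∃ ξ' : lp (fun _ : ℕ => H) 2, ξ = ξ' := ⟨⟨ξ, memℓp_two_iff_summable.2 hξ⟩, rfl⟩
  obtain ⟨η, rfl⟩ : ∃ η' : lp (fun _ : ℕ => H) 2, η = η' := ⟨⟨η, memℓp_two_iff_summable.2 hη⟩, rfl⟩
  have key : Continuous fun x : M.toStarSubalgebra => ⟪η, amplification H (F x) ξ⟫_ℂ := by
    simp only [inner_amplification_polarization _ ξ η]
    exact ((((h _).sub (h _)).sub (continuous_const.mul (h _))).add
      (continuous_const.mul (h _))).div_const 4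
  simpa only [Function.comp_def, inner_amplification] using key

end VonNeumannAlgebra

theorem mainTheorem12 {H : Type*} [NormedAddCommGroup H] [InnerProductSpace ℂ H] [CompleteSpace H]
    (M N : VonNeumannAlgebra H) (hNM : N ≤ M)
    (E : M.toStarSubalgebra →ₗ[ℂ] N.toStarSubalgebra)
    (hE : VonNeumannAlgebra.IsConditionalExpectation hNM E)
    (c : ℝ) (hc : 0 < c) (hPP : VonNeumannAlgebra.PimsnerPopaInequality E c)
    (F : M.toStarSubalgebra →ₗ[ℂ] N.toStarSubalgebra)
    (hF : VonNeumannAlgebra.IsConditionalExpectation hNM F) :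
    VonNeumannAlgebra.IsNormalMap F := by
  refine VonNeumannAlgebra.isNormalMap_of_continuous_inner F fun ξ => ?_
  obtain ⟨ζ, hζ⟩ := hE.exists_inner_eq hF hc hPP ξ
  simp only [hζ]
  exact VonNeumannAlgebra.continuous_inner_amplification ζ
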